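/- For a graph $H$ let $\chi'(H)$ denote its chromatic index, i.e. the least number of colors in a proper edge coloring of $H$ (so $\chi'(K_n) = n$ for odd $n \ge 3$). We say that a simple graph $G$ of order $n$ has a maximal edge coloring if there is a proper edge coloring of $G$ with colors from a palette of $\chi'(K_n)$ colors such that adding to $G$ any edge joining two distinct non-adjacent vertices, in any color of the palette, makes the coloring improper. For a positive integer $n$ let $MEC(n)$ be the set of all $m \in \mathbb{N}$ for which there exists a graph with exactly $n$ vertices and exactly $m$ edges that has a maximal edge coloring. Theorem. If $n \ge 9$ is odd and $m \in MEC(n)$, then $$m \ge \frac{1}{4}n^2 + \frac{1}{2}n - \frac{3}{4}.$$ -/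

import Mathlib

namespace SimpleGraph

/-- A proper edge coloring of `G` with colors from `K`: edges that share an endpoint get distinct
colors, i.e. a proper vertex coloring of the line graph. -/
abbrev ProperEdgeColoring {V : Type*} (G : SimpleGraph V) (K : Type*) :=
  G.lineGraph.Coloring K

/-- The chromatic index of `G`: the least number of colors in a proper edge coloring. -/
noncomputable def chromaticIndex {V : Type*} (G : SimpleGraph V) : ℕ∞ :=
  G.lineGraph.chromaticNumber

/-- A proper edge coloring `C` of `G` is maximal if, for every two distinct non-adjacent vertices
`u`, `v` and every color `c` of the palette, the coloring obtained from `C` by adding the edge `uv`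
in color `c` is not proper: no proper edge coloring of `G + uv` agrees with `C` on `G` and gives
`uv` the color `c`. -/
def ProperEdgeColoring.IsMaximal {V K : Type*} {G : SimpleGraph V}
    (C : G.ProperEdgeColoring K) : Prop :=
  ∀ u v : V, u ≠ v → ¬ G.Adj u v → ∀ c : K,
    ¬ ∃ C' : (G ⊔ edge u v).ProperEdgeColoring K,
      (∀ (e : Sym2 V) (he : e ∈ G.edgeSet) (he' : e ∈ (G ⊔ edge u v).edgeSet),
        C' ⟨e, he'⟩ = C ⟨e, he⟩) ∧
      (∀ h : s(u, v) ∈ (G ⊔ edge u v).edgeSet, C' ⟨s(u, v), h⟩ = c)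

/-- A graph on the vertex set `Fin n` has a maximal edge coloring if it has a maximal proper edge
coloring with a palette of `χ'(K_n)` colors (a finite number). -/
def HasMaximalEdgeColoring {n : ℕ} (G : SimpleGraph (Fin n)) : Prop :=
  ∃ C : G.ProperEdgeColoring (Fin (completeGraph (Fin n)).chromaticIndex.toNat), C.IsMaximal

/-- The spectrum `MEC(n)`: all numbers of edges of graphs of order `n` that have a maximal edge
coloring. -/
def MEC (n : ℕ) : Set ℕ :=
  {m | ∃ G : SimpleGraph (Fin n), G.edgeSet.ncard = m ∧ G.HasMaximalEdgeColoring}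

end SimpleGraph

/-!
Write `n = 2k + 1`; the palette has `n` colors since a color class of an odd complete graph omits a
vertex (`SimpleGraph.chromaticIndex_completeGraph_of_odd`). Let `a x` be the number of colors missing
at the vertex `x`, so that `x` has degree `n - a x`, and degree `a x - 1` in the complement `H` of the
graph. Maximality says that the sets of colors missing at two vertices adjacent in `H` are disjoint;
in particular `a x + a y ≤ n` for them. The claim is that the degree sum is at least `2k² + 4k`.

If `a v + a w = n` for some edge `vw` of `H`, then the colors missing at `v` and those missing at `w`
partition the palette into `M` and `N`. All colors of `M` are present at each non-neighbor of `v`, of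
which there are `|M| - 1`; since these span few edges among themselves, many edges with color in `M`
leave their set. The same holds for `N` and `w`, and edges with color in `M` are not edges with color
in `N`. Adding up gives the bound, except in one case where it falls short by one edge, which a parity
argument excludes (`IsMaximalEdgeLabelling.le_sum_degree_of_tight`).

If `a x + a y ≤ n - 1` on all edges of `H`, then disjointness makes `a` small on average on every short
odd closed walk of `H`, since each color is missing on an independent set of the walk. If the claim
fails, the sum of `a` is too large for such walks to exist, so `H` is bipartite, and for bipartite `H`
the claim is a short count (`sum_le_of_short_odd_walks`,
`IsMaximalEdgeLabelling.le_sum_degree_of_not_tight`).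
-/

section

open Finset

/-! ### Degree conditions on a graph without short odd cycles -/

/-- A bipartite graph on `2k + 1` vertices whose edges have degree sum at most `2k - 2` has at most
`k(k - 1)` edges. If one side, of size `p`, has all its degrees at most `2k - 1 - p`, this is
`p(2k - 1 - p) ≤ k(k - 1)`. Otherwise each side has a vertex violating its bound; these two are not
joined, so each is joined to all the rest of the other side, and all other degrees are small. -/
theorem sum_degree_le_of_bipartite {V : Type*} [Fintype V] [DecidableEq V] (H : SimpleGraph V)
    [DecidableRel H.Adj] (X : Finset V) (k : ℤ) (hV : (Fintype.card V : ℤ) = 2 * k + 1)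
    (hX : ∀ x ∈ X, ∀ y ∈ X, ¬ H.Adj x y) (hY : ∀ x ∉ X, ∀ y ∉ X, ¬ H.Adj x y)
    (hedge : ∀ x y, H.Adj x y → (H.degree x : ℤ) + H.degree y ≤ 2 * k - 2) :
    ∑ x, (H.degree x : ℤ) ≤ 2 * (k * (k - 1)) := by
  classical
  set p : ℤ := (X.card : ℤ) with hp
  set q : ℤ := (Xᶜ.card : ℤ) with hq
  have hpq : p + q = 2 * k + 1 := by
    rw [← hV, hp, hq, ← Nat.cast_add, Finset.card_add_card_compl]
  have hp0 : 0 ≤ p := by positivity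
  have hq0 : 0 ≤ q := by positivity
  have hnX : ∀ x ∈ X, H.neighborFinset x ⊆ Xᶜ := fun x hx y hy => by
    rw [SimpleGraph.mem_neighborFinset] at hy
    rw [mem_compl]
    exact fun h => hX x hx y h hy
  have hnY : ∀ x ∈ Xᶜ, H.neighborFinset x ⊆ X := fun x hx y hy => by
    rw [SimpleGraph.mem_neighborFinset] at hy
    by_contra h
    exact hY x (mem_compl.1 hx) y h hy
  have hdX : ∀ x ∈ X, (H.degree x : ℤ) ≤ q := fun x hx => by
    rw [hq, Nat.cast_le]
    exact card_le_card (hnX x hx)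
  have hdY : ∀ x ∈ Xᶜ, (H.degree x : ℤ) ≤ p := fun x hx => by
    rw [hp, Nat.cast_le]
    exact card_le_card (hnY x hx)
  -- both sides of the bipartition see every edge once
  have hXY : ∑ x ∈ X, (H.degree x : ℤ) = ∑ y ∈ Xᶜ, (H.degree y : ℤ) := by
    have h := Finset.sum_card_bipartiteAbove_eq_sum_card_bipartiteBelow (s := X) (t := Xᶜ) H.Adj
    have h1 : ∀ x ∈ X, (Xᶜ.bipartiteAbove H.Adj x).card = H.degree x := fun x hx => by
      rw [← SimpleGraph.card_neighborFinset_eq_degree]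
      congr 1
      ext y
      simp only [mem_bipartiteAbove, SimpleGraph.mem_neighborFinset, and_iff_right_iff_imp]
      exact fun h => hnX x hx (by simpa using h)
    have h2 : ∀ y ∈ Xᶜ, (X.bipartiteBelow H.Adj y).card = H.degree y := fun y hy => by
      rw [← SimpleGraph.card_neighborFinset_eq_degree]
      congr 1
      ext x
      simp only [mem_bipartiteBelow, SimpleGraph.mem_neighborFinset]
      rw [H.adj_comm]
      exact and_iff_right_of_imp fun h => hnY y hy (by simpa using h)
    rw [sum_congr rfl h1, sum_congr rfl h2] at h
    exact_mod_cast h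
  have htot : ∑ x, (H.degree x : ℤ) = ∑ x ∈ X, (H.degree x : ℤ) + ∑ y ∈ Xᶜ, (H.degree y : ℤ) :=
    (sum_add_sum_compl X _).symm
  have key : ∀ s : ℤ, 0 ≤ (s - k) * (s - k + 1) := fun s => by
    rcases le_or_gt k s with h | h
    · exact mul_nonneg (by linarith) (by linarith)
    · exact mul_nonneg_of_nonpos_of_nonpos (by linarith) (by linarith [Int.add_one_le_iff.2 h])
  by_cases h1 : ∀ x ∈ X, (H.degree x : ℤ) ≤ q - 2
  · have := sum_le_sum h1
    rw [sum_const, nsmul_eq_mul, ← hp] at this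
    have hq' : q = 2 * k + 1 - p := by linarith
    rw [hq'] at this
    nlinarith [key p]
  by_cases h2 : ∀ x ∈ Xᶜ, (H.degree x : ℤ) ≤ p - 2
  · have := sum_le_sum h2
    rw [sum_const, nsmul_eq_mul, ← hq] at this
    have hp' : p = 2 * k + 1 - q := by linarith
    rw [hp'] at this
    nlinarith [key q]
  push Not at h1 h2
  obtain ⟨x₀, hx₀, hdx₀⟩ := h1
  obtain ⟨y₀, hy₀, hdy₀⟩ := h2
  -- `x₀` and `y₀` are not joined, hence each misses exactly the other
  have hxy : ¬ H.Adj x₀ y₀ := fun h => by linarith [hedge _ _ h]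
  have hx0n : H.neighborFinset x₀ = Xᶜ.erase y₀ := by
    apply eq_of_subset_of_card_le
    · intro y hy
      rw [mem_erase]
      exact ⟨fun h => hxy (by simpa [h] using hy), hnX _ hx₀ hy⟩
    · rw [SimpleGraph.card_neighborFinset_eq_degree, card_erase_of_mem hy₀]
      omega
  have hy0n : H.neighborFinset y₀ = X.erase x₀ := by
    apply eq_of_subset_of_card_le
    · intro y hy
      rw [mem_erase]
      exact ⟨fun h => hxy (by rw [h] at hy; simpa [H.adj_comm] using hy), hnY _ hy₀ hy⟩
    · rw [SimpleGraph.card_neighborFinset_eq_degree, card_erase_of_mem hx₀]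
      omega
  have hX' : ∑ x ∈ X, (H.degree x : ℤ) ≤ p * (q - 2) + 1 := by
    rw [← add_sum_erase X _ hx₀]
    have h : ∀ x ∈ X.erase x₀, (H.degree x : ℤ) ≤ q - 2 := fun x hx => by
      rw [← hy0n, SimpleGraph.mem_neighborFinset] at hx
      linarith [hedge _ _ hx]
    have h' := sum_le_sum h
    rw [sum_const, nsmul_eq_mul, card_erase_of_mem hx₀, Nat.cast_sub (card_pos.2 ⟨x₀, hx₀⟩),
      ← hp] at h'
    have : (H.degree x₀ : ℤ) ≤ q - 1 := by
      rw [← SimpleGraph.card_neighborFinset_eq_degree, hx0n, card_erase_of_mem hy₀,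
        Nat.cast_sub (card_pos.2 ⟨y₀, hy₀⟩)]
      simp [hq]
    push_cast at h'
    nlinarith
  have hY' : ∑ x ∈ Xᶜ, (H.degree x : ℤ) ≤ q * (p - 2) + 1 := by
    rw [← add_sum_erase Xᶜ _ hy₀]
    have h : ∀ x ∈ Xᶜ.erase y₀, (H.degree x : ℤ) ≤ p - 2 := fun x hx => by
      rw [← hx0n, SimpleGraph.mem_neighborFinset] at hx
      linarith [hedge _ _ hx]
    have h' := sum_le_sum h
    rw [sum_const, nsmul_eq_mul, card_erase_of_mem hy₀, Nat.cast_sub (card_pos.2 ⟨y₀, hy₀⟩),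
      ← hq] at h'
    have : (H.degree y₀ : ℤ) ≤ p - 1 := by
      rw [← SimpleGraph.card_neighborFinset_eq_degree, hy0n, card_erase_of_mem hx₀,
        Nat.cast_sub (card_pos.2 ⟨x₀, hx₀⟩)]
      simp [hp]
    push_cast at h'
    nlinarith
  -- the larger side has at least `k + 1` vertices
  have hp1 : 1 ≤ p := by rw [hp]; exact_mod_cast card_pos.2 ⟨x₀, hx₀⟩
  have hq1 : 1 ≤ q := by rw [hq]; exact_mod_cast card_pos.2 ⟨y₀, hy₀⟩
  rcases le_or_gt (k + 1) p with h | h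
  · have hq' : q = 2 * k + 1 - p := by linarith
    rw [hq'] at hX'
    nlinarith
  · have hq' : p = 2 * k + 1 - q := by linarith
    rw [hq'] at hY'
    have : k + 1 ≤ q := by linarith [Int.lt_add_one_iff.1 h]
    nlinarith

/-- The boundary case `t v = 0` of `sum_le_of_short_odd_walks`, for an edge `u u'` outside the
neighborhood of `v`: if one neighbor `b` of `v` has its other neighbors among those of `u`, then a
count shows that all of them do and that they are joined to every neighbor `z ≠ u'` of `u`, so that
`z` has degree at least `deg v + 1`. -/
theorem not_forall_erase_subset {V : Type*} [Fintype V] [DecidableEq V] (H : SimpleGraph V)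
    [DecidableRel H.Adj] {k : ℤ} (hk : 4 ≤ k) {v u u' : V} (huv : ¬ H.Adj v u)
    (hdv : (H.degree v : ℤ) = k - 1)
    (hdB : ∀ b, H.Adj v b → (H.degree b : ℤ) = k - 1)
    (hdZ : ∀ z ∈ (H.neighborFinset u).erase u', (H.degree z : ℤ) = k - 1)
    (hc : (((H.neighborFinset u).erase u').card : ℤ) ≤ k - 2)
    (hc' : (((H.neighborFinset u).erase u').card : ℤ) +
      (((H.neighborFinset u').erase u).card : ℤ) = k - 1)
    (hs : ∀ b, H.Adj v b → (H.neighborFinset b).erase v ⊆ (H.neighborFinset u).erase u' ∨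
      (H.neighborFinset b).erase v ⊆ (H.neighborFinset u').erase u) :
    ¬ ∃ b, H.Adj v b ∧ (H.neighborFinset b).erase v ⊆ (H.neighborFinset u).erase u' := by
  rintro ⟨b₀, hb₀, hb₀s⟩
  have hbc : ∀ b, H.Adj v b → (((H.neighborFinset b).erase v).card : ℤ) = k - 2 := by
    intro b hb
    rw [card_erase_of_mem (by simpa using hb.symm), SimpleGraph.card_neighborFinset_eq_degree]
    have h1 := hdB b hb
    omega
  have h4 := card_le_card hb₀s
  have h5 := hbc b₀ hb₀
  have hall : ∀ b, H.Adj v b →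
      (H.neighborFinset b).erase v = (H.neighborFinset u).erase u' := by
    intro b hb
    have h8 := hbc b hb
    rcases hs b hb with h | h
    · apply eq_of_subset_of_card_le h
      omega
    · have := card_le_card h
      omega
  obtain ⟨z, hz⟩ : ((H.neighborFinset u).erase u').Nonempty := by
    rw [← card_pos]; omega
  have hsubz : insert u (H.neighborFinset v) ⊆ H.neighborFinset z := by
    intro b hb
    rw [mem_insert] at hb
    rw [SimpleGraph.mem_neighborFinset]
    rcases hb with rfl | hb
    · rw [mem_erase, SimpleGraph.mem_neighborFinset] at hz
      exact hz.2.symm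
    · rw [SimpleGraph.mem_neighborFinset] at hb
      rw [← hall b hb, mem_erase, SimpleGraph.mem_neighborFinset] at hz
      exact hz.2.symm
  have h9 := card_le_card hsubz
  rw [card_insert_of_notMem (by simpa using huv)] at h9
  simp only [SimpleGraph.card_neighborFinset_eq_degree] at h9
  have h10 := hdZ z hz
  omega

/-- If the degrees are `k + t x - 1` on `2k + 1` vertices, `t x + t y ≤ 0` along each edge, and `t`
is very negative on triangles and on closed walks of length five, then `∑ t ≤ 2 - k`.

Otherwise let `v` maximize `t`, and measure for every vertex by how much `t` falls short of `t v`,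
or of `-t v` if it is a neighbor of `v`. The total deficit is then so small that no short odd cycle
fits; hence the graph is bipartite, one side consisting of the neighbors of `v` and of the
vertices that share no neighbor with `v`. The bound for bipartite graphs gives a contradiction. -/
theorem sum_le_of_short_odd_walks {V : Type*} [Fintype V] [DecidableEq V] (H : SimpleGraph V)
    [DecidableRel H.Adj] (t : V → ℤ) (k : ℤ) (hk : 4 ≤ k)
    (hV : (Fintype.card V : ℤ) = 2 * k + 1)
    (hdeg : ∀ x, (H.degree x : ℤ) = k + t x - 1)
    (hedge : ∀ x y, H.Adj x y → t x + t y ≤ 0)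
    (htri : ∀ x y z, H.Adj x y → H.Adj y z → H.Adj z x → t x + t y + t z ≤ 1 - k)
    (hpent : ∀ x y z w u, H.Adj x y → H.Adj y z → H.Adj z w → H.Adj w u → H.Adj u x →
      t x + t y + t z + t w + t u ≤ 2 - k) :
    ∑ x, t x ≤ 2 - k := by
  classical
  by_contra hS
  push Not at hS
  have hne : (univ : Finset V).Nonempty := by
    rw [← card_pos, card_univ]; omega
  obtain ⟨v, -, hv⟩ := exists_max_image univ t hne
  replace hv : ∀ x, t x ≤ t v := fun x => hv x (mem_univ x)
  set τ := t v with hτ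
  have hτ0 : 0 ≤ τ := by
    by_contra h
    have : ∑ x, t x ≤ ∑ x : V, (-1 : ℤ) := sum_le_sum fun x _ => by linarith [hv x]
    rw [sum_const, card_univ, nsmul_eq_mul, hV] at this
    linarith
  -- the deficit of a vertex relative to the largest value its position with respect to `v` allows
  let δ : V → ℤ := fun x => if H.Adj v x then -τ - t x else τ - t x
  have hδB : ∀ x, H.Adj v x → δ x = -τ - t x := fun x hx => if_pos hx
  have hδA : ∀ x, ¬ H.Adj v x → δ x = τ - t x := fun x hx => if_neg hx
  have hδ0 : ∀ x, 0 ≤ δ x := fun x => by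
    by_cases h : H.Adj v x
    · rw [hδB x h]; linarith [hedge v x h]
    · rw [hδA x h]; linarith [hv x]
  have hδsum : ∑ x, δ x ≤ k - 3 - 2 * τ ^ 2 + 3 * τ := by
    have h : ∀ x, δ x = τ - t x - 2 * τ * (if H.Adj v x then 1 else 0) := fun x => by
      by_cases h : H.Adj v x
      · rw [hδB x h, if_pos h]; ring
      · rw [hδA x h, if_neg h]; ring
    have hB : (∑ x, if H.Adj v x then (1 : ℤ) else 0) = k + τ - 1 := by
      rw [← hdeg v, sum_boole, ← SimpleGraph.card_neighborFinset_eq_degree,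
        SimpleGraph.neighborFinset_eq_filter]
    simp_rw [h]
    rw [sum_sub_distrib, sum_sub_distrib, ← mul_sum, hB, sum_const, card_univ, nsmul_eq_mul, hV]
    linarith
  have hδle : ∀ S : Finset V, ∑ x ∈ S, δ x ≤ k - 3 - 2 * τ ^ 2 + 3 * τ := fun S =>
    (sum_le_univ_sum_of_nonneg hδ0).trans hδsum
  have hδ2 : ∀ x y, x ≠ y → δ x + δ y ≤ k - 3 - 2 * τ ^ 2 + 3 * τ := fun x y h => by
    rw [← sum_pair h]; exact hδle _
  have hδ3 : ∀ x y z, x ≠ y → x ≠ z → y ≠ z → δ x + δ y + δ z ≤ k - 3 - 2 * τ ^ 2 + 3 * τ :=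
    fun x y z h1 h2 h3 => by
      have := hδle {x, y, z}
      rw [sum_insert (by simp [h1, h2]), sum_pair h3] at this
      linarith
  have hδ4 : ∀ x y z w, x ≠ y → x ≠ z → x ≠ w → y ≠ z → y ≠ w → z ≠ w →
      δ x + δ y + δ z + δ w ≤ k - 3 - 2 * τ ^ 2 + 3 * τ :=
    fun x y z w h1 h2 h3 h4 h5 h6 => by
      have := hδle {x, y, z, w}
      rw [sum_insert (by simp [h1, h2, h3]), sum_insert (by simp [h4, h5]), sum_pair h6] at this
      linarith
  have hneAB : ∀ {x y}, H.Adj v x → ¬ H.Adj v y → x ≠ y := fun hx hy h => hy (h ▸ hx)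
  -- no edge inside the neighborhood of `v`: the deficits only leave room for it if `t v = 1`
  have hBB : ∀ b b', H.Adj v b → H.Adj v b' → ¬ H.Adj b b' := by
    intro b b' hb hb' hbb
    have h1 := htri v b b' hb hbb hb'.symm
    have h2 := hδ2 b b' hbb.ne
    rw [hδB b hb, hδB b' hb'] at h2
    have hτ1 : τ = 1 := by nlinarith [sq_nonneg (τ - 1)]
    -- equality holds: all other vertices have deficit `0`
    have hA : ∀ y, ¬ H.Adj v y → t y = 1 := fun y hy => by
      have h3 := hδ3 b b' y hbb.ne (hneAB hb hy) (hneAB hb' hy)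
      rw [hδB b hb, hδB b' hb', hδA y hy, hτ1] at h3
      linarith [hv y]
    have hfull : ∀ y, ¬ H.Adj v y → H.neighborFinset y = H.neighborFinset v := fun y hy => by
      apply eq_of_subset_of_card_le
      · intro z hz
        rw [SimpleGraph.mem_neighborFinset] at hz ⊢
        by_contra hvz
        linarith [hedge y z hz, hA y hy, hA z hvz]
      · have h3 := hdeg y
        have h4 := hdeg v
        rw [hA y hy] at h3
        rw [← hτ, hτ1] at h4
        rw [SimpleGraph.card_neighborFinset_eq_degree, SimpleGraph.card_neighborFinset_eq_degree]
        omega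
    have hsub : (H.neighborFinset v)ᶜ ⊆ H.neighborFinset b := fun y hy => by
      rw [mem_compl, SimpleGraph.mem_neighborFinset] at hy
      have : b ∈ H.neighborFinset y := by rw [hfull y hy]; simpa using hb
      rw [SimpleGraph.mem_neighborFinset] at this ⊢
      exact this.symm
    have h3 := card_le_card hsub
    have h4 := card_add_card_compl (H.neighborFinset v)
    rw [SimpleGraph.card_neighborFinset_eq_degree] at h3 h4
    have h5 := hdeg v
    have h6 := hdeg b
    have h7 := hedge v b hb
    omega
  -- if both ends of an edge outside the neighborhood of `v` have a neighbor inside, there is a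
  -- triangle, or a closed walk of length five through `v`
  have hAA : ∀ y z b b', ¬ H.Adj v y → ¬ H.Adj v z → H.Adj y z → H.Adj v b → H.Adj v b' →
      H.Adj z b → ¬ H.Adj y b' := by
    intro y z b b' hy hz hyz hb hb' hzb hyb
    by_cases hbb : b = b'
    · subst hbb
      have h1 := htri y z b hyz hzb hyb.symm
      have h2 := hδ3 b y z (hneAB hb hy) (hneAB hb hz) hyz.ne
      rw [hδB b hb, hδA y hy, hδA z hz] at h2
      nlinarith [sq_nonneg (τ - 1)]
    · have h1 := hpent v b z y b' hb hzb.symm hyz.symm hyb hb'.symm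
      have h2 := hδ4 b b' y z hbb (hneAB hb hy) (hneAB hb hz) (hneAB hb' hy) (hneAB hb' hz) hyz.ne
      rw [hδB b hb, hδB b' hb', hδA y hy, hδA z hz] at h2
      nlinarith [sq_nonneg (τ - 1)]
  have hAAA : ∀ x y z, ¬ H.Adj v x → ¬ H.Adj v y → ¬ H.Adj v z → H.Adj x y → H.Adj y z →
      ¬ H.Adj z x := by
    intro x y z hx hy hz hxy hyz hzx
    have h1 := htri x y z hxy hyz hzx
    have h2 := hδ3 x y z hxy.ne hzx.ne' hyz.ne
    rw [hδA x hx, hδA y hy, hδA z hz] at h2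
    nlinarith [sq_nonneg τ]
  -- no edge joins two vertices without neighbors in the neighborhood of `v`
  have hstar : ∀ y y', ¬ H.Adj v y → ¬ H.Adj v y' → (∀ b, H.Adj v b → ¬ H.Adj y b) →
      (∀ b, H.Adj v b → ¬ H.Adj y' b) → ¬ H.Adj y y' := by
    intro y y' hy hy' hyB hyB' hyy
    have hN : ∀ z, H.Adj y z → ¬ H.Adj v z := fun z hz hvz => hyB z hvz hz
    have hN' : ∀ z, H.Adj y' z → ¬ H.Adj v z := fun z hz hvz => hyB' z hvz hz
    have hdisj : Disjoint (H.neighborFinset y) (H.neighborFinset y') := by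
      rw [disjoint_left]
      intro z hz hz'
      rw [SimpleGraph.mem_neighborFinset] at hz hz'
      exact hAAA y y' z hy hy' (hN z hz) hyy hz' hz.symm
    have hsub : H.neighborFinset y ∪ H.neighborFinset y' ⊆ ((H.neighborFinset v)ᶜ).erase v := by
      intro z hz
      rw [mem_union, SimpleGraph.mem_neighborFinset, SimpleGraph.mem_neighborFinset] at hz
      rw [mem_erase, mem_compl, SimpleGraph.mem_neighborFinset]
      rcases hz with hz | hz
      · exact ⟨fun h => hy (h ▸ hz).symm, hN z hz⟩
      · exact ⟨fun h => hy' (h ▸ hz).symm, hN' z hz⟩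
    have hvmem : v ∈ (H.neighborFinset v)ᶜ := by simp
    have hcard := card_le_card hsub
    have hcompl := card_add_card_compl (H.neighborFinset v)
    rw [card_union_of_disjoint hdisj, card_erase_of_mem hvmem] at hcard
    simp only [SimpleGraph.card_neighborFinset_eq_degree] at hcard hcompl
    have hdv := hdeg v
    have hdy := hdeg y
    have hdy' := hdeg y'
    have hpos := card_pos.2 ⟨v, hvmem⟩
    have hle : t y + t y' ≤ 3 - k - τ := by omega
    have hδyy := hδ2 y y' hyy.ne
    rw [hδA y hy, hδA y' hy'] at hδyy
    -- the deficits of `y` and `y'` only leave room for the edge if `t v = 0`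
    have hτz : τ = 0 := by nlinarith
    rw [← hτ, hτz] at hdv
    rw [hτz] at hle hδyy hv
    -- equality holds: all other vertices have `t = 0`
    have hzero : ∀ z, z ≠ y → z ≠ y' → t z = 0 := fun z h1 h2 => by
      have h3 := hδ3 y y' z hyy.ne h1.symm h2.symm
      rw [hδA y hy, hδA y' hy', hτz] at h3
      have h4 : δ z = - t z := by
        by_cases h : H.Adj v z
        · rw [hδB z h, hτz]; ring
        · rw [hδA z h, hτz]; ring
      linarith [hv z]
    set Z := (H.neighborFinset y).erase y' with hZ
    set Z' := (H.neighborFinset y').erase y with hZ'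
    have hZc : (Z.card : ℤ) = k + t y - 2 := by
      rw [hZ, card_erase_of_mem (by simpa using hyy), SimpleGraph.card_neighborFinset_eq_degree]
      have : 0 < H.degree y := (H.degree_pos_iff_exists_adj y).2 ⟨y', hyy⟩
      omega
    have hZc' : (Z'.card : ℤ) = k + t y' - 2 := by
      rw [hZ', card_erase_of_mem (by simpa using hyy.symm),
        SimpleGraph.card_neighborFinset_eq_degree]
      have : 0 < H.degree y' := (H.degree_pos_iff_exists_adj y').2 ⟨y, hyy.symm⟩
      omega
    have heq : H.neighborFinset y ∪ H.neighborFinset y' = ((H.neighborFinset v)ᶜ).erase v := by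
      apply eq_of_subset_of_card_le hsub
      rw [card_union_of_disjoint hdisj, card_erase_of_mem hvmem]
      simp only [SimpleGraph.card_neighborFinset_eq_degree]
      omega
    -- the neighbors of `b` other than `v` all lie on the same side of the edge `y y'`
    have hside : ∀ b, H.Adj v b → (H.neighborFinset b).erase v ⊆ Z ∨
        (H.neighborFinset b).erase v ⊆ Z' := by
      intro b hb
      by_contra hcon
      rw [not_or, not_subset, not_subset] at hcon
      obtain ⟨⟨z', hz', hzZ⟩, z, hz, hzZ'⟩ := hcon
      have hmem : ∀ x ∈ (H.neighborFinset b).erase v, x ∈ Z ∨ x ∈ Z' := by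
        intro x hx
        rw [mem_erase, SimpleGraph.mem_neighborFinset] at hx
        have hx' : x ∈ H.neighborFinset y ∪ H.neighborFinset y' := by
          rw [heq, mem_erase, mem_compl, SimpleGraph.mem_neighborFinset]
          exact ⟨hx.1, fun h => hBB b x hb h hx.2⟩
        have hxy : x ≠ y := fun h => hyB b hb (h ▸ hx.2).symm
        have hxy' : x ≠ y' := fun h => hyB' b hb (h ▸ hx.2).symm
        rw [mem_union] at hx'
        rcases hx' with h | h
        · exact Or.inl (mem_erase.2 ⟨hxy', h⟩)
        · exact Or.inr (mem_erase.2 ⟨hxy, h⟩)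
      have h1 := (hmem z' hz').resolve_left hzZ
      have h2 := (hmem z hz).resolve_right hzZ'
      rw [hZ', mem_erase, SimpleGraph.mem_neighborFinset] at h1
      rw [hZ, mem_erase, SimpleGraph.mem_neighborFinset] at h2
      rw [mem_erase, SimpleGraph.mem_neighborFinset] at hz hz'
      have h3 := hpent b z y y' z' hz.2 h2.2.symm hyy h1.2 hz'.2.symm
      have hb0 := hzero b (hneAB hb hy) (hneAB hb hy')
      have hz0 := hzero z h2.2.ne' h2.1
      have hz0' := hzero z' h1.1 h1.2.ne'
      linarith
    have hbc : ∀ b, H.Adj v b → (((H.neighborFinset b).erase v).card : ℤ) = k - 2 := by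
      intro b hb
      rw [card_erase_of_mem (by simpa using hb.symm), SimpleGraph.card_neighborFinset_eq_degree]
      have h1 := hdeg b
      rw [hzero b (hneAB hb hy) (hneAB hb hy')] at h1
      omega
    have hvle : ∀ x, t x ≤ 0 := fun x => by linarith [hv x]
    have hdB : ∀ b, H.Adj v b → (H.degree b : ℤ) = k - 1 := fun b hb => by
      rw [hdeg, hzero b (hneAB hb hy) (hneAB hb hy')]; ring
    have hdZ : ∀ z ∈ Z, (H.degree z : ℤ) = k - 1 := fun z hz => by
      rw [hZ, mem_erase, SimpleGraph.mem_neighborFinset] at hz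
      rw [hdeg, hzero z hz.2.ne' hz.1]; ring
    have hdZ' : ∀ z ∈ Z', (H.degree z : ℤ) = k - 1 := fun z hz => by
      rw [hZ', mem_erase, SimpleGraph.mem_neighborFinset] at hz
      rw [hdeg, hzero z hz.1 hz.2.ne']; ring
    obtain ⟨b, hb⟩ : ∃ b, H.Adj v b := (H.degree_pos_iff_exists_adj v).1 (by omega)
    rcases hside b hb with h | h
    · exact not_forall_erase_subset H hk hy (by linarith) hdB hdZ (by linarith [hvle y])
        (by linarith) hside ⟨b, hb, h⟩
    · exact not_forall_erase_subset H hk hy' (by linarith) hdB hdZ' (by linarith [hvle y'])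
        (by linarith) (fun b hb => (hside b hb).symm) ⟨b, hb, h⟩
  -- so the graph is bipartite
  let X : Finset V := univ.filter fun x => ¬ H.Adj v x ∧ ∃ b, H.Adj v b ∧ H.Adj x b
  have hXmem : ∀ x, x ∈ X ↔ ¬ H.Adj v x ∧ ∃ b, H.Adj v b ∧ H.Adj x b := fun x => by simp [X]
  have hbip := sum_degree_le_of_bipartite H X k hV
    (fun x hx y hy hxy => by
      obtain ⟨hx, b, hb, hxb⟩ := (hXmem x).1 hx
      obtain ⟨hy, b', hb', hyb⟩ := (hXmem y).1 hy
      exact hAA x y b' b hx hy hxy hb' hb hyb hxb)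
    (fun x hx y hy hxy => by
      rw [hXmem] at hx hy
      push Not at hx hy
      by_cases hvx : H.Adj v x
      · by_cases hvy : H.Adj v y
        · exact hBB x y hvx hvy hxy
        · exact hy hvy x hvx hxy.symm
      · by_cases hvy : H.Adj v y
        · exact hx hvx y hvy hxy
        · exact hstar x y hvx hvy (hx hvx) (hy hvy) hxy)
    (fun x y hxy => by linarith [hdeg x, hdeg y, hedge x y hxy])
  simp_rw [hdeg] at hbip
  rw [sum_sub_distrib, sum_add_distrib, sum_const, sum_const, card_univ, nsmul_eq_mul,
    nsmul_eq_mul, hV] at hbip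
  linarith

/-! ### Maximal edge colorings and the colors missing at a vertex -/

/-- A maximal proper edge coloring of `G`, given as a symmetric function of two vertices of which
only the values at adjacent pairs matter: edges at a common vertex have distinct colors, and every
color is present at one end at least of each non-adjacent pair. -/
structure IsMaximalEdgeLabelling {V C : Type*} (G : SimpleGraph V) (col : V → V → C) : Prop where
  symm : ∀ x y, col x y = col y x
  proper : ∀ x y z, G.Adj x y → G.Adj x z → col x y = col x z → y = z
  maximal : ∀ x y, x ≠ y → ¬ G.Adj x y → ∀ c,
    (∃ z, G.Adj x z ∧ col x z = c) ∨ ∃ z, G.Adj y z ∧ col y z = c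

namespace IsMaximalEdgeLabelling

variable {V C : Type*} {G : SimpleGraph V} {col : V → V → C}

/-- A set of vertices that is perfectly matched inside itself by the edges of one color is even. -/
theorem even_card_of_matched (h : IsMaximalEdgeLabelling G col) (X : Finset V) (c : C)
    (hX : ∀ x ∈ X, ∃ y ∈ X, G.Adj x y ∧ col x y = c) : Even X.card := by
  choose! f hf hadj hcol using hX
  have hsum : ∑ _x ∈ X, (1 : ZMod 2) = 0 := by
    apply sum_involution (fun x _ => f x)
    · intro x _; decide
    · intro x hx _ hfx
      exact (hadj x hx).ne hfx.symm
    · exact hf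
    · intro x hx
      apply h.proper (f x) _ _ (hadj _ (hf x hx)) (hadj x hx).symm
      rw [hcol _ (hf x hx), h.symm, hcol x hx]
  rw [sum_const, nsmul_eq_mul, mul_one] at hsum
  exact (ZMod.natCast_eq_zero_iff_even).1 hsum

variable [DecidableEq C] [DecidableRel G.Adj]

variable (G col) in
/-- The indicator of `x y` being an edge with color in `S`, as an integer. -/
def ind (S : Finset C) (x y : V) : ℤ := if G.Adj x y ∧ col x y ∈ S then 1 else 0

theorem ind_nonneg (S : Finset C) (x y : V) : 0 ≤ ind G col S x y := by
  unfold ind; split_ifs <;> norm_num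

theorem ind_le_one (S : Finset C) (x y : V) : ind G col S x y ≤ 1 := by
  unfold ind; split_ifs <;> norm_num

theorem ind_eq_one_iff {S : Finset C} {x y : V} :
    ind G col S x y = 1 ↔ G.Adj x y ∧ col x y ∈ S := by
  unfold ind; split_ifs with h <;> simp [h]

theorem ind_self (S : Finset C) (x : V) : ind G col S x x = 0 := by simp [ind]

theorem ind_comm (h : IsMaximalEdgeLabelling G col) (S : Finset C) (x y : V) :
    ind G col S x y = ind G col S y x := by
  simp only [ind, G.adj_comm x y, h.symm x y]

theorem sum_sum_ind_comm (h : IsMaximalEdgeLabelling G col) (S : Finset C) (X Y : Finset V) :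
    ∑ x ∈ X, ∑ y ∈ Y, ind G col S x y = ∑ x ∈ Y, ∑ y ∈ X, ind G col S x y := by
  rw [sum_comm]
  exact sum_congr rfl fun y _ => sum_congr rfl fun x _ => h.ind_comm S x y

theorem sum_sum_ind_le [DecidableEq V] (M : Finset C) (B : Finset V) :
    ∑ x ∈ B, ∑ y ∈ B, ind G col M x y ≤ B.card * (B.card - 1) := by
  have : ∀ x ∈ B, ∑ y ∈ B, ind G col M x y ≤ B.card - 1 := fun x hx => by
    rw [← add_sum_erase B _ hx, ind_self, zero_add]
    refine (sum_le_sum fun y _ => ind_le_one M x y).trans_eq ?_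
    rw [sum_const, card_erase_of_mem hx, nsmul_eq_mul, mul_one,
      Nat.cast_sub (card_pos.2 ⟨x, hx⟩), Nat.cast_one]
  refine (sum_le_sum this).trans_eq ?_
  rw [sum_const, nsmul_eq_mul]

variable [Fintype V] [Fintype C]

variable (G col) in
/-- The colors that are not present at the vertex `x`. -/
def missing (x : V) : Finset C := univ.filter fun c => ∀ y, G.Adj x y → col x y ≠ c

theorem notMem_missing {x : V} {c : C} :
    c ∉ missing G col x ↔ ∃ y, G.Adj x y ∧ col x y = c := by
  simp [missing]

theorem disjoint_missing (h : IsMaximalEdgeLabelling G col) {x y : V} (hne : x ≠ y)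
    (hxy : ¬ G.Adj x y) : Disjoint (missing G col x) (missing G col y) := by
  rw [disjoint_left]
  intro c hx hy
  rcases h.maximal x y hne hxy c with hc | hc
  · exact notMem_missing.2 hc hx
  · exact notMem_missing.2 hc hy

theorem sum_ind (h : IsMaximalEdgeLabelling G col) (S : Finset C) (x : V) :
    ∑ y, ind G col S x y = (S \ missing G col x).card := by
  unfold ind
  rw [sum_boole, Nat.cast_inj, ← card_image_of_injOn (f := col x)]
  · congr 1
    ext c
    rw [mem_image, mem_sdiff, notMem_missing]
    constructor
    · rintro ⟨y, hy, rfl⟩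
      exact ⟨(mem_filter.1 hy).2.2, y, (mem_filter.1 hy).2.1, rfl⟩
    · rintro ⟨hc, y, hy, rfl⟩
      exact ⟨y, mem_filter.2 ⟨mem_univ _, hy, hc⟩, rfl⟩
  · intro y hy z hz hyz
    simp only [coe_filter, mem_univ, true_and, Set.mem_ofPred_eq] at hy hz
    exact h.proper x y z hy.1 hz.1 hyz

theorem sum_ind_univ (x : V) : ∑ y, ind G col univ x y = G.degree x := by
  unfold ind
  rw [sum_boole, ← SimpleGraph.card_neighborFinset_eq_degree,
    SimpleGraph.neighborFinset_eq_filter]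
  simp

theorem card_missing (h : IsMaximalEdgeLabelling G col) (x : V) :
    ((missing G col x).card : ℤ) = Fintype.card C - G.degree x := by
  rw [← sum_ind_univ (col := col) x, h.sum_ind, ← compl_eq_univ_sdiff, card_compl,
    Nat.cast_sub (card_le_univ _)]
  ring

variable [DecidableEq V]

/-! ### Counting the edges with colors from a set -/

/-- The number of edges with color in `M`, doubled, when all these colors are present at every
vertex of `B`: an edge with just one end in `B` is counted from that end. -/
theorem sum_sum_ind_saturated (h : IsMaximalEdgeLabelling G col) {M : Finset C} {B : Finset V}
    (hB : ∀ b ∈ B, Disjoint (missing G col b) M) :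
    ∑ x, ∑ y, ind G col M x y = 2 * (M.card * B.card) -
      ∑ x ∈ B, ∑ y ∈ B, ind G col M x y + ∑ x ∈ Bᶜ, ∑ y ∈ Bᶜ, ind G col M x y := by
  have h1 : ∑ x ∈ B, ∑ y, ind G col M x y = M.card * B.card := by
    rw [sum_congr rfl fun x hx => by rw [h.sum_ind, sdiff_eq_self_of_disjoint (hB x hx).symm],
      sum_const, nsmul_eq_mul, mul_comm]
  have h2 : ∀ X : Finset V, ∑ x ∈ X, ∑ y, ind G col M x y =
      ∑ x ∈ X, ∑ y ∈ B, ind G col M x y + ∑ x ∈ X, ∑ y ∈ Bᶜ, ind G col M x y := fun X => by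
    rw [← sum_add_distrib]
    exact sum_congr rfl fun x _ => (sum_add_sum_compl B _).symm
  have h3 := h2 B
  have h4 := h2 Bᶜ
  rw [h.sum_sum_ind_comm M Bᶜ B] at h4
  rw [← sum_add_sum_compl B]
  linarith

/-- The bound that results from `sum_sum_ind_saturated` since `B` spans at most `|B|(|B| - 1) / 2`
edges. Equality is the subject of `eq_of_sum_sum_ind_le`. -/
theorem le_sum_sum_ind (h : IsMaximalEdgeLabelling G col) {M : Finset C} {B : Finset V}
    (hB : ∀ b ∈ B, Disjoint (missing G col b) M) :
    2 * ((M.card : ℤ) * B.card) - B.card * (B.card - 1) ≤ ∑ x, ∑ y, ind G col M x y := by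
  rw [h.sum_sum_ind_saturated hB]
  have h1 := sum_sum_ind_le (G := G) (col := col) M B
  have h2 : 0 ≤ ∑ x ∈ Bᶜ, ∑ y ∈ Bᶜ, ind G col M x y :=
    sum_nonneg fun x _ => sum_nonneg fun y _ => ind_nonneg M x y
  linarith

/-- Equality in `le_sum_sum_ind` forces all edges inside `B` to be present with color in `M`, and
every edge with color in `M` to have an end in `B`. -/
theorem eq_of_sum_sum_ind_le (h : IsMaximalEdgeLabelling G col) {M : Finset C} {B : Finset V}
    (hB : ∀ b ∈ B, Disjoint (missing G col b) M)
    (hle : ∑ x, ∑ y, ind G col M x y ≤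
      2 * ((M.card : ℤ) * B.card) - B.card * (B.card - 1)) :
    ∑ x ∈ B, ∑ y ∈ B, ind G col M x y = B.card * (B.card - 1) ∧
      ∀ x ∉ B, ∀ y ∉ B, G.Adj x y → col x y ∉ M := by
  rw [h.sum_sum_ind_saturated hB] at hle
  have h1 := sum_sum_ind_le (G := G) (col := col) M B
  have h0 : ∀ x ∈ Bᶜ, 0 ≤ ∑ y ∈ Bᶜ, ind G col M x y := fun x _ =>
    sum_nonneg fun y _ => ind_nonneg M x y
  have h2 := sum_nonneg h0
  refine ⟨by linarith, fun x hx y hy hxy hc => ?_⟩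
  have h3 := (sum_eq_zero_iff_of_nonneg h0).1 (by linarith) x (mem_compl.2 hx)
  have h4 := (sum_eq_zero_iff_of_nonneg fun y _ => ind_nonneg M x y).1 h3 y (mem_compl.2 hy)
  rw [ind_eq_one_iff.2 ⟨hxy, hc⟩] at h4
  exact one_ne_zero h4

/-- The parity argument for the equality case. Each vertex of `B` has just two `M`-edges leaving `B`.
If `|B|` were even, each color of `M` missing at `u₁` or at `u₂` would match some vertex of `B` to a
vertex other than `u₁` and `u₂`; but the edges from `B` to `u₁` and `u₂` leave too few for that. -/
theorem odd_card_of_two_exceptional (h : IsMaximalEdgeLabelling G col) {M : Finset C}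
    {B : Finset V} {u₁ u₂ : V} (hne : u₁ ≠ u₂)
    (hu₁ : u₁ ∉ B) (hu₂ : u₂ ∉ B) (hB : ∀ b ∈ B, Disjoint (missing G col b) M)
    (hBB : ∑ x ∈ B, ∑ y ∈ B, ind G col M x y = B.card * (B.card - 1))
    (hR : ∀ x ∉ B, ∀ y ∉ B, G.Adj x y → col x y ∉ M)
    (hM : M.card = B.card + 1)
    (hdisj : Disjoint (missing G col u₁) (missing G col u₂)) : Odd B.card := by
  by_contra hodd
  rw [Nat.not_odd_iff_even] at hodd
  set Q : Finset V := (Bᶜ.erase u₁).erase u₂ with hQ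
  have hmemQ : ∀ y, y ∉ B → y ≠ u₁ → y ≠ u₂ → y ∈ Q := fun y h1 h2 h3 => by
    simp [hQ, h1, h2, h3]
  -- a color of `M` missing at one exceptional vertex leaves `B ∪ {u}`, for `u` the other one
  have hleave : ∀ u u', u ∉ B → u' ∉ B → ∀ c ∈ M, c ∈ missing G col u →
      c ∉ missing G col u' → ∃ b ∈ B, ∃ y ∉ B, y ≠ u ∧ y ≠ u' ∧ G.Adj b y ∧ col b y = c := by
    intro u u' hu hu' c hc hcu hcu'
    by_contra hcon
    push Not at hcon
    have hev := h.even_card_of_matched (insert u' B) c (by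
      intro x hx
      rw [mem_insert] at hx
      rcases hx with rfl | hx
      · obtain ⟨y, hy, hyc⟩ := notMem_missing.1 hcu'
        refine ⟨y, mem_insert_of_mem ?_, hy, hyc⟩
        by_contra hyB
        exact hR x hu' y hyB hy (hyc ▸ hc)
      · obtain ⟨y, hy, hyc⟩ := notMem_missing.1 (disjoint_right.1 (hB x hx) hc)
        refine ⟨y, ?_, hy, hyc⟩
        by_contra hyB
        rw [mem_insert, not_or] at hyB
        refine hcon x hx y hyB.2 (fun hyu => ?_) hyB.1 hy hyc
        subst hyu
        exact notMem_missing.2 ⟨x, hy.symm, by rw [h.symm, hyc]⟩ hcu)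
    rw [card_insert_of_notMem hu', Nat.even_add_one] at hev
    exact hev hodd
  have hsub : M ∩ (missing G col u₁ ∪ missing G col u₂) ⊆
      ((B ×ˢ Q).filter fun e => G.Adj e.1 e.2 ∧ col e.1 e.2 ∈ M).image fun e => col e.1 e.2 := by
    intro c hc
    rw [mem_inter, mem_union] at hc
    have : ∃ b ∈ B, ∃ y ∉ B, y ≠ u₁ ∧ y ≠ u₂ ∧ G.Adj b y ∧ col b y = c := by
      rcases hc.2 with h1 | h1
      · exact hleave u₁ u₂ hu₁ hu₂ c hc.1 h1 (disjoint_left.1 hdisj h1)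
      · obtain ⟨b, hb, y, hy, h2, h3, h4⟩ :=
          hleave u₂ u₁ hu₂ hu₁ c hc.1 h1 (disjoint_right.1 hdisj h1)
        exact ⟨b, hb, y, hy, h3, h2, h4⟩
    obtain ⟨b, hb, y, hy, h1, h2, h3, h4⟩ := this
    rw [mem_image]
    refine ⟨(b, y), ?_, h4⟩
    rw [mem_filter, mem_product]
    exact ⟨⟨hb, hmemQ y hy h1 h2⟩, h3, by rw [h4]; exact hc.1⟩
  have hlow : ((M ∩ (missing G col u₁ ∪ missing G col u₂)).card : ℤ) ≤
      ∑ x ∈ B, ∑ y ∈ Q, ind G col M x y := by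
    rw [← sum_product' (s := B) (t := Q)]
    unfold ind
    rw [sum_boole, Nat.cast_le]
    exact (card_le_card hsub).trans card_image_le
  -- the exact number of these edges
  have hu : ∀ u, u ∉ B → ∑ x ∈ B, ind G col M x u = M.card - (M ∩ missing G col u).card := by
    intro u hu
    have h1 : ∑ y, ind G col M u y = ∑ y ∈ B, ind G col M u y := by
      rw [← sum_add_sum_compl B, add_eq_left]
      refine sum_eq_zero fun y hy => ?_
      unfold ind
      rw [if_neg]
      exact fun h2 => hR u hu y (mem_compl.1 hy) h2.1 h2.2
    rw [sum_congr rfl fun x _ => h.ind_comm M x u, ← h1, h.sum_ind,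
      ← card_sdiff_add_card_inter M (missing G col u)]
    push_cast
    ring
  have hsplit : ∀ x, ∑ y, ind G col M x y = ∑ y ∈ B, ind G col M x y + (ind G col M x u₁ +
      (ind G col M x u₂ + ∑ y ∈ Q, ind G col M x y)) := fun x => by
    rw [hQ, add_sum_erase _ _ (mem_erase.2 ⟨hne.symm, mem_compl.2 hu₂⟩),
      add_sum_erase _ _ (mem_compl.2 hu₁), sum_add_sum_compl]
  have htot : ∑ x ∈ B, ∑ y, ind G col M x y = M.card * B.card := by
    rw [sum_congr rfl fun x hx => by rw [h.sum_ind, sdiff_eq_self_of_disjoint (hB x hx).symm],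
      sum_const, nsmul_eq_mul, mul_comm]
  rw [sum_congr rfl fun x _ => hsplit x, sum_add_distrib, sum_add_distrib, sum_add_distrib, hBB,
    hu u₁ hu₁, hu u₂ hu₂] at htot
  rw [inter_union_distrib_left, card_union_of_disjoint (hdisj.mono inter_subset_right
    inter_subset_right)] at hlow
  push_cast [hM] at htot hlow
  nlinarith

/-! ### The bound on the degree sum -/

/-- The bound if two non-adjacent vertices `v`, `w` together miss all colors. Then the sets `M` and
`N` of colors missing at them partition the palette; let `B` and `P` be the sets of vertices at which
all of `M`, respectively all of `N`, is present. As `B` contains the non-neighbors of `v` and `P`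
those of `w`, `|B| ≥ |M| - 1` and `|P| ≥ |N| - 1`, and `le_sum_sum_ind` for `(M, B)` and `(N, P)`
suffices unless equality holds in both. In that case it is one edge short, so that equality would
hold in `le_sum_sum_ind` as well, and the parity argument makes `|B|` and `|P|` both odd, though they
add up to the odd number `|V| - 2`. -/
theorem le_sum_degree_of_tight (h : IsMaximalEdgeLabelling G col) {k : ℤ}
    (hV : (Fintype.card V : ℤ) = 2 * k + 1)
    (hC : (Fintype.card C : ℤ) = 2 * k + 1) {v w : V} (hvw : v ≠ w) (hadj : ¬ G.Adj v w)
    (htight : ((missing G col v).card : ℤ) + (missing G col w).card = 2 * k + 1) :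
    2 * k ^ 2 + 4 * k ≤ ∑ x, (G.degree x : ℤ) := by
  set M := missing G col v with hMdef
  set N := missing G col w with hNdef
  have hMN : Disjoint M N := h.disjoint_missing hvw hadj
  have huniv : M ∪ N = univ := by
    rw [← card_eq_iff_eq_univ, card_union_of_disjoint hMN]
    omega
  set B : Finset V := univ.filter fun x => Disjoint (missing G col x) M with hBdef
  set P : Finset V := univ.filter fun x => Disjoint (missing G col x) N with hPdef
  have hB : ∀ b ∈ B, Disjoint (missing G col b) M := fun b hb => (mem_filter.1 hb).2
  have hP : ∀ b ∈ P, Disjoint (missing G col b) N := fun b hb => (mem_filter.1 hb).2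
  have hdeg : ∀ x, (G.degree x : ℤ) ≤ 2 * k := fun x => by
    have := G.degree_lt_card_verts x
    omega
  -- no vertex has all `2 k + 1` colors
  have hBP : Disjoint B P := by
    rw [disjoint_left]
    intro x hx hx'
    have h1 : Disjoint (missing G col x) (M ∪ N) :=
      disjoint_union_right.2 ⟨hB x hx, hP x hx'⟩
    rw [huniv] at h1
    have h2 := h.card_missing x
    rw [disjoint_self_iff_empty _ |>.1 (h1.mono_right (subset_univ _)), card_empty] at h2
    have h3 := hdeg x
    omega
  have hnon : ∀ x, ((univ.filter fun y => x ≠ y ∧ ¬ G.Adj x y).card : ℤ) =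
      (missing G col x).card - 1 := fun x => by
    have h1 : (univ.filter fun y => x ≠ y ∧ ¬ G.Adj x y) = Gᶜ.neighborFinset x := by
      ext y; simp
    rw [h1, SimpleGraph.card_neighborFinset_eq_degree, SimpleGraph.degree_compl, h.card_missing]
    have := G.degree_lt_card_verts x
    omega
  have hBcard : (M.card : ℤ) - 1 ≤ B.card := by
    rw [hMdef, ← hnon v, Nat.cast_le]
    refine card_le_card fun x hx => ?_
    rw [mem_filter] at hx
    exact mem_filter.2 ⟨mem_univ _, (h.disjoint_missing hx.2.1 hx.2.2).symm⟩
  have hPcard : (N.card : ℤ) - 1 ≤ P.card := by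
    rw [hNdef, ← hnon w, Nat.cast_le]
    refine card_le_card fun x hx => ?_
    rw [mem_filter] at hx
    exact mem_filter.2 ⟨mem_univ _, (h.disjoint_missing hx.2.1 hx.2.2).symm⟩
  have hBPcard : B.card + P.card ≤ Fintype.card V := by
    rw [← card_union_of_disjoint hBP]
    exact card_le_univ _
  have hsum : ∑ x, (G.degree x : ℤ) =
      ∑ x, ∑ y, ind G col M x y + ∑ x, ∑ y, ind G col N x y := by
    rw [← sum_add_distrib]
    refine sum_congr rfl fun x _ => ?_
    rw [← sum_ind_univ (col := col), h.sum_ind, h.sum_ind, h.sum_ind, ← huniv, union_sdiff_distrib,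
      card_union_of_disjoint (hMN.mono sdiff_subset sdiff_subset)]
    push_cast
    rfl
  have heven : Even (∑ x, (G.degree x : ℤ)) := by
    have := G.sum_degrees_eq_twice_card_edges
    exact ⟨G.edgeFinset.card, by rw [← two_mul]; exact_mod_cast this⟩
  have h1 := h.le_sum_sum_ind hB
  have h2 := h.le_sum_sum_ind hP
  by_contra hlt
  push Not at hlt
  -- the degree sum is even, so a violation of the bound is one by at least `2`
  have hlt' : ∑ x, (G.degree x : ℤ) ≤ 2 * k ^ 2 + 4 * k - 2 := by
    obtain ⟨d, hd⟩ := heven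
    rw [hd] at hlt ⊢
    have : d < k ^ 2 + 2 * k := by linarith
    linarith [Int.add_one_le_iff.2 this]
  have hsq : 1 ≤ ((M.card : ℤ) - N.card) ^ 2 := by
    have : (M.card : ℤ) - N.card ≠ 0 := by omega
    have := Int.one_le_abs this
    rw [← sq_abs]
    nlinarith
  by_cases hex : (B.card : ℤ) = M.card - 1 ∧ (P.card : ℤ) = N.card - 1
  · obtain ⟨hb, hp⟩ := hex
    rw [hsum] at hlt'
    rw [hb] at h1
    rw [hp] at h2
    have hN' : (N.card : ℤ) = 2 * k + 1 - M.card := by linarith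
    have hBeq := h.eq_of_sum_sum_ind_le hB (by rw [hb]; nlinarith)
    have hPeq := h.eq_of_sum_sum_ind_le hP (by rw [hp]; nlinarith)
    obtain ⟨u₁, u₂, hne, hU⟩ : ∃ u₁ u₂, u₁ ≠ u₂ ∧ (B ∪ P)ᶜ = {u₁, u₂} := by
      rw [← card_eq_two, card_compl, card_union_of_disjoint hBP]
      omega
    have hu₁ : u₁ ∈ (B ∪ P)ᶜ := by rw [hU]; simp
    have hu₂ : u₂ ∈ (B ∪ P)ᶜ := by rw [hU]; simp
    rw [mem_compl, mem_union, not_or] at hu₁ hu₂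
    have hnadj : ¬ G.Adj u₁ u₂ := fun hadj' => by
      have : col u₁ u₂ ∈ M ∪ N := by rw [huniv]; exact mem_univ _
      rcases mem_union.1 this with hc | hc
      · exact hBeq.2 u₁ hu₁.1 u₂ hu₂.1 hadj' hc
      · exact hPeq.2 u₁ hu₁.2 u₂ hu₂.2 hadj' hc
    have hdisj := h.disjoint_missing hne hnadj
    have o1 := h.odd_card_of_two_exceptional hne hu₁.1 hu₂.1 hB hBeq.1 hBeq.2 (by omega) hdisj
    have o2 := h.odd_card_of_two_exceptional hne hu₁.2 hu₂.2 hP hPeq.1 hPeq.2 (by omega) hdisj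
    obtain ⟨i, hi⟩ := o1
    obtain ⟨j, hj⟩ := o2
    omega
  · -- with `s = |M| - |B|` and `s' = |N| - |P|`, here `s (s + 1) + s' (s' + 1) ≤ 2`
    obtain ⟨s, hs⟩ : ∃ s : ℤ, s = M.card - B.card := ⟨_, rfl⟩
    obtain ⟨s', hs'⟩ : ∃ s' : ℤ, s' = N.card - P.card := ⟨_, rfl⟩
    have hss : s * (s + 1) + s' * (s' + 1) ≤ 2 := by
      have hcases : (s = 1 ∧ s' = 0) ∨ (s = 1 ∧ s' = -1) ∨ (s = 0 ∧ s' = 0) ∨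
          (s = 0 ∧ s' = 1) ∨ (s = -1 ∧ s' = 1) := by omega
      rcases hcases with h | h | h | h | h <;> rw [h.1, h.2] <;> norm_num
    have hb : (B.card : ℤ) = M.card - s := by linarith
    have hp : (P.card : ℤ) = N.card - s' := by linarith
    rw [hb] at h1
    rw [hp] at h2
    rw [hsum] at hlt'
    have hN' : (N.card : ℤ) = 2 * k + 1 - M.card := by linarith
    rw [hN'] at h2 hsq
    nlinarith

/-- The bound if no two non-adjacent vertices together miss all colors: this is
`sum_le_of_short_odd_walks` for the complement of `G`, with `t` the excess over `k` of the number of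
missing colors. -/
theorem le_sum_degree_of_not_tight (h : IsMaximalEdgeLabelling G col) {k : ℤ} (hk : 4 ≤ k)
    (hV : (Fintype.card V : ℤ) = 2 * k + 1) (hC : (Fintype.card C : ℤ) = 2 * k + 1)
    (htight : ∀ x y, x ≠ y → ¬ G.Adj x y →
      ((missing G col x).card : ℤ) + (missing G col y).card ≠ 2 * k + 1) :
    2 * k ^ 2 + 4 * k ≤ ∑ x, (G.degree x : ℤ) := by
  have hdisj : ∀ {x y}, Gᶜ.Adj x y → Disjoint (missing G col x) (missing G col y) := fun hxy =>
    h.disjoint_missing hxy.1 hxy.2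
  have hpair : ∀ (c : C) {x y}, Gᶜ.Adj x y → ((if c ∈ missing G col x then 1 else 0) +
      (if c ∈ missing G col y then 1 else 0) : ℤ) ≤ 1 := fun c x y hxy => by
    by_cases hx : c ∈ missing G col x
    · simp [hx, disjoint_left.1 (hdisj hxy) hx]
    · simp only [hx, if_false, zero_add]
      split_ifs <;> norm_num
  have hsum := sum_le_of_short_odd_walks Gᶜ (fun x => ((missing G col x).card : ℤ) - k) k hk hV
    (fun x => by
      rw [SimpleGraph.degree_compl, h.card_missing]
      have := G.degree_lt_card_verts x
      omega)
    (fun x y hxy => by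
      have h1 := card_le_univ (missing G col x ∪ missing G col y)
      rw [card_union_of_disjoint (hdisj hxy)] at h1
      have h2 := htight x y hxy.1 hxy.2
      omega)
    (fun x y z hxy hyz hzx => by
      have h1 := card_le_univ (missing G col x ∪ missing G col y ∪ missing G col z)
      rw [card_union_of_disjoint (disjoint_union_left.2 ⟨(hdisj hzx).symm, hdisj hyz⟩),
        card_union_of_disjoint (hdisj hxy)] at h1
      omega)
    (fun x y z w u hxy hyz hzw hwu hux => by
      -- each color is missing at no more than two vertices of a closed walk of length five
      have h1 : ∀ c, ((if c ∈ missing G col x then 1 else 0) +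
          (if c ∈ missing G col y then 1 else 0) + (if c ∈ missing G col z then 1 else 0) +
          (if c ∈ missing G col w then 1 else 0) + (if c ∈ missing G col u then 1 else 0) : ℤ) ≤
          2 := fun c => by
        have haux : ∀ a₁ a₂ a₃ a₄ a₅ : ℤ, a₁ + a₂ ≤ 1 → a₂ + a₃ ≤ 1 → a₃ + a₄ ≤ 1 →
            a₄ + a₅ ≤ 1 → a₅ + a₁ ≤ 1 → a₁ + a₂ + a₃ + a₄ + a₅ ≤ 2 := by omega
        exact haux _ _ _ _ _ (hpair c hxy) (hpair c hyz) (hpair c hzw) (hpair c hwu) (hpair c hux)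
      have h2 := sum_le_sum fun c (_ : c ∈ univ) => h1 c
      simp only [sum_add_distrib, sum_boole, filter_mem_eq_inter, univ_inter, sum_const,
        card_univ, nsmul_eq_mul, hC] at h2
      linarith)
  have heven : Even (∑ x, (G.degree x : ℤ)) := by
    have := G.sum_degrees_eq_twice_card_edges
    exact ⟨G.edgeFinset.card, by rw [← two_mul]; exact_mod_cast this⟩
  simp_rw [h.card_missing] at hsum
  rw [sum_sub_distrib, sum_sub_distrib, sum_const, sum_const, card_univ, nsmul_eq_mul,
    nsmul_eq_mul, hV, hC] at hsum
  obtain ⟨d, hd⟩ := heven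
  rw [hd] at hsum ⊢
  by_contra hlt
  push Not at hlt
  have : d < k ^ 2 + 2 * k := by linarith
  nlinarith [Int.add_one_le_iff.2 this]

theorem le_sum_degree (h : IsMaximalEdgeLabelling G col) {k : ℤ} (hk : 4 ≤ k)
    (hV : (Fintype.card V : ℤ) = 2 * k + 1) (hC : (Fintype.card C : ℤ) = 2 * k + 1) :
    2 * k ^ 2 + 4 * k ≤ ∑ x, (G.degree x : ℤ) := by
  by_cases htight : ∃ v w, v ≠ w ∧ ¬ G.Adj v w ∧
      ((missing G col v).card : ℤ) + (missing G col w).card = 2 * k + 1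
  · obtain ⟨v, w, hvw, hadj, hcard⟩ := htight
    exact h.le_sum_degree_of_tight hV hC hvw hadj hcard
  · push Not at htight
    exact h.le_sum_degree_of_not_tight hk hV hC htight

end IsMaximalEdgeLabelling

/-! ### The palette, and the passage from edge colorings to labellings -/

namespace SimpleGraph

/-- A maximal proper edge coloring, read as a function of the two ends of an edge; non-adjacent
pairs get an arbitrary color. -/
theorem ProperEdgeColoring.IsMaximal.exists_labelling {V K : Type*} [Nonempty K]
    {G : SimpleGraph V} {c : G.ProperEdgeColoring K} (hc : c.IsMaximal) :
    ∃ col : V → V → K, IsMaximalEdgeLabelling G col := by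
  classical
  obtain ⟨k₀⟩ := ‹Nonempty K›
  let f : Sym2 V → K := fun e => if he : e ∈ G.edgeSet then c ⟨e, he⟩ else k₀
  have hf : ∀ e (he : e ∈ G.edgeSet), f e = c ⟨e, he⟩ := fun e he => dif_pos he
  refine ⟨fun x y => f s(x, y), fun x y => by rw [Sym2.eq_swap], fun x y z hy hz hyz => ?_,
    fun x y hne hxy k => ?_⟩
  · by_contra hne
    rw [hf _ ((mem_edgeSet G).2 hy), hf _ ((mem_edgeSet G).2 hz)] at hyz
    refine c.valid (lineGraph_adj_iff_exists.2 ⟨fun h => hne ?_, x, ?_, ?_⟩) hyz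
    · exact Sym2.congr_right.1 (congrArg Subtype.val h)
    · simp
    · simp
  · by_contra hcon
    push Not at hcon
    -- the color `k` is free at both ends, so the edge `xy` can be added in it
    have hfree : ∀ e ∈ G.edgeSet, (x ∈ e ∨ y ∈ e) → f e ≠ k := by
      rintro e he (hv | hv)
      · obtain ⟨z, rfl⟩ := Sym2.mem_iff_exists.1 hv
        exact hcon.1 z ((mem_edgeSet G).1 he)
      · obtain ⟨z, rfl⟩ := Sym2.mem_iff_exists.1 hv
        exact hcon.2 z ((mem_edgeSet G).1 he)
    have hnew : s(x, y) ∉ G.edgeSet := fun h => hxy ((mem_edgeSet G).1 h)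
    have hcases : ∀ e ∈ (G ⊔ edge x y).edgeSet, e ∈ G.edgeSet ∨ e = s(x, y) := fun e he => by
      rw [edgeSet_sup, edgeSet_edge_of_ne hne] at he
      rcases he with he | he
      · exact Or.inl he
      · exact Or.inr he
    refine hc x y hne hxy k ⟨Coloring.mk (fun e => if e.1 ∈ G.edgeSet then f e.1 else k) ?_,
      fun e he he' => ?_, fun h => ?_⟩
    · rintro ⟨e₁, he₁⟩ ⟨e₂, he₂⟩ hadj
      obtain ⟨h12, v, hv₁, hv₂⟩ := lineGraph_adj_iff_exists.1 hadj
      have h12' : e₁ ≠ e₂ := fun h => h12 (Subtype.ext h)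
      dsimp only at hv₁ hv₂ ⊢
      rcases hcases e₁ he₁ with h₁ | h₁ <;> rcases hcases e₂ he₂ with h₂ | h₂
      · rw [if_pos h₁, if_pos h₂, hf _ h₁, hf _ h₂]
        exact c.valid (lineGraph_adj_iff_exists.2
          ⟨fun h => h12' (congrArg Subtype.val h), v, hv₁, hv₂⟩)
      · subst h₂
        rw [if_pos h₁, if_neg hnew]
        refine hfree e₁ h₁ ?_
        rcases Sym2.mem_iff.1 hv₂ with rfl | rfl
        · exact Or.inl hv₁
        · exact Or.inr hv₁
      · subst h₁
        rw [if_pos h₂, if_neg hnew]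
        refine (hfree e₂ h₂ ?_).symm
        rcases Sym2.mem_iff.1 hv₁ with rfl | rfl
        · exact Or.inl hv₂
        · exact Or.inr hv₂
      · exact absurd (h₁.trans h₂.symm) h12'
    · change (if e ∈ G.edgeSet then f e else k) = c ⟨e, he⟩
      rw [if_pos he, hf e he]
    · change (if s(x, y) ∈ G.edgeSet then f s(x, y) else k) = k
      rw [if_neg hnew]

/-- Every color of a proper edge coloring of `K_n` is present at an even number of vertices, hence
for odd `n` at no more than `n - 1`, while each vertex sees `n - 1` colors. A proper edge coloring
of a complete graph is maximal for want of non-adjacent pairs, so the lemmas on maximal labellings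
apply to it. -/
theorem le_of_properEdgeColoring_completeGraph {n m : ℕ} (hn : 2 ≤ n) (hodd : Odd n)
    (c : (completeGraph (Fin n)).ProperEdgeColoring (Fin m)) : n ≤ m := by
  classical
  have hadj : (completeGraph (Fin n)).Adj ⟨0, by omega⟩ ⟨1, by omega⟩ := by
    simp [completeGraph]
  have : Nonempty (Fin m) := ⟨c ⟨s(_, _), (mem_edgeSet _).2 hadj⟩⟩
  have hmax : c.IsMaximal := fun u v huv h => absurd huv (by simpa [completeGraph] using h)
  obtain ⟨col, h⟩ := hmax.exists_labelling
  -- every color is present at an even number of vertices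
  have hcol : ∀ k : Fin m, (univ.filter fun x => ∃ y,
      (completeGraph (Fin n)).Adj x y ∧ col x y = k).card ≤ n - 1 := by
    intro k
    have hev := h.even_card_of_matched (univ.filter fun x => ∃ y,
      (completeGraph (Fin n)).Adj x y ∧ col x y = k) k (fun x hx => by
        obtain ⟨y, hy, hxy⟩ := (mem_filter.1 hx).2
        exact ⟨y, mem_filter.2 ⟨mem_univ _, x, hy.symm, by rw [h.symm, hxy]⟩, hy, hxy⟩)
    have hle := card_le_univ (univ.filter fun x => ∃ y,
      (completeGraph (Fin n)).Adj x y ∧ col x y = k)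
    rw [Fintype.card_fin] at hle
    obtain ⟨i, hi⟩ := hev
    obtain ⟨j, hj⟩ := hodd
    omega
  have hrow : ∀ x : Fin n, (univ.filter fun k => ∃ y,
      (completeGraph (Fin n)).Adj x y ∧ col x y = k).card = n - 1 := by
    intro x
    have h1 := IsMaximalEdgeLabelling.sum_ind_univ (G := completeGraph (Fin n)) (col := col) x
    rw [h.sum_ind, Nat.cast_inj] at h1
    have h2 : (completeGraph (Fin n)).degree x = n - 1 := by
      simp
    rw [h2] at h1
    rw [← h1]
    congr 1
    ext k
    rw [mem_sdiff, IsMaximalEdgeLabelling.notMem_missing]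
    simp
  have hdc := sum_card_bipartiteAbove_eq_sum_card_bipartiteBelow (s := (univ : Finset (Fin n)))
    (t := (univ : Finset (Fin m)))
    (fun x k => ∃ y, (completeGraph (Fin n)).Adj x y ∧ col x y = k)
  simp only [bipartiteAbove, bipartiteBelow] at hdc
  rw [sum_congr rfl fun x _ => hrow x] at hdc
  have hle := sum_le_sum fun k (_ : k ∈ univ) => hcol k
  rw [← hdc, sum_const, sum_const, card_univ, card_univ, Fintype.card_fin, Fintype.card_fin,
    smul_eq_mul, smul_eq_mul] at hle
  exact Nat.le_of_mul_le_mul_right hle (by omega)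

theorem chromaticIndex_completeGraph_of_odd {n : ℕ} (hn : 2 ≤ n) (hodd : Odd n) :
    (completeGraph (Fin n)).chromaticIndex = n := by
  have : NeZero n := ⟨by omega⟩
  refine le_antisymm ?_ ?_
  · -- color the edge `ij` with `i + j` modulo `n`
    have c : (completeGraph (Fin n)).ProperEdgeColoring (Fin n) :=
      Coloring.mk (fun e => Sym2.lift ⟨fun i j => i + j, fun i j => add_comm i j⟩ e.1) (by
        rintro ⟨e₁, he₁⟩ ⟨e₂, he₂⟩ hadj heq
        obtain ⟨h12, v, hv₁, hv₂⟩ := lineGraph_adj_iff_exists.1 hadj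
        obtain ⟨y, rfl⟩ := Sym2.mem_iff_exists.1 hv₁
        obtain ⟨z, rfl⟩ := Sym2.mem_iff_exists.1 hv₂
        have hyz : v + y = v + z := heq
        obtain rfl := add_left_cancel hyz
        exact h12 rfl)
    have := c.colorable.chromaticNumber_le
    rwa [Fintype.card_fin] at this
  · refine le_chromaticNumber_iff_colorable.2 fun m hm => ?_
    exact le_of_properEdgeColoring_completeGraph hn hodd hm.some

end SimpleGraph

end

theorem theorem5 (n : ℕ) (hn : 9 ≤ n) (hodd : Odd n) (m : ℕ) (hm : m ∈ SimpleGraph.MEC n) :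
    (n : ℝ) ^ 2 / 4 + (n : ℝ) / 2 - 3 / 4 ≤ (m : ℝ) := by
  classical
  obtain ⟨G, rfl, c, hc⟩ := hm
  have hK : (SimpleGraph.completeGraph (Fin n)).chromaticIndex.toNat = n := by
    rw [SimpleGraph.chromaticIndex_completeGraph_of_odd (by omega) hodd]
    rfl
  have : Nonempty (Fin (SimpleGraph.completeGraph (Fin n)).chromaticIndex.toNat) :=
    ⟨⟨0, by omega⟩⟩
  obtain ⟨col, h⟩ := hc.exists_labelling
  obtain ⟨k, hk⟩ := hodd
  have hbound := h.le_sum_degree (k := k) (by omega) (by rw [Fintype.card_fin, hk]; push_cast; rfl)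
    (by rw [Fintype.card_fin, hK, hk]; push_cast; rfl)
  have hm : ∑ x, (G.degree x : ℤ) = 2 * (G.edgeSet.ncard : ℤ) := by
    rw [← SimpleGraph.coe_edgeFinset, Set.ncard_coe_finset]
    exact_mod_cast G.sum_degrees_eq_twice_card_edges
  rw [hm] at hbound
  have hreal : 2 * (k : ℝ) ^ 2 + 4 * k ≤ 2 * (G.edgeSet.ncard : ℝ) := by exact_mod_cast hbound
  have hn' : (n : ℝ) = 2 * k + 1 := by rw [hk]; push_cast; rfl
  rw [hn']
  linarith
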